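/- Let $\mathbb{A}$ be a countably infinite set of atoms and let $\mathrm{Perm}$ be the group of finite permutations of $\mathbb{A}$ (bijections moving only finitely many atoms). A set $C\subseteq\mathbb{A}$ supports an element $x$ of a $\mathrm{Perm}$-set if every $g\in\mathrm{Perm}$ fixing $C$ pointwise satisfies $g\cdot x=x$; a finitely supported $x$ has a least finite support $\mathrm{supp}(x)$. A nominal set is a $\mathrm{Perm}$-set all of whose elements are finitely supported; nominal sets and equivariant maps form a category $\mathrm{Perm}\text{-}\mathbf{Nom}$. Elements $x,y$ are separated, $x\mathrel{\#}y$, if they have disjoint finite supports. The separated product is $X\ast Y=\{(x,y)\in X\times Y\mid x\mathrel{\#}y\}$, and the set of separated words is $X^{(\ast)}=\bigcup_n X^{(n)}$ with $X^{(0)}=1$ and $X^{(n+1)}=X^{(n)}\ast X$. Let $\mathrm{Perm}$ act on partial functions $f\colon X\rightharpoonup Y$ by $(g\cdot f)(x)=g\cdot f(g^{-1}\cdot x)$ (defined whenever $f(g^{-1}\cdot x)$ is). The magic wand $X\mathrel{-\!\ast}Y$ is the nominal set of those partial functions $f\colon X\rightharpoonup Y$ that are separating: $f$ is finitely supported, $f(x)$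 is defined if and only if $f\mathrel{\#}x$, and $\mathrm{supp}(f)=\bigcup_{x\in\mathrm{dom}(f)}\bigl(\mathrm{supp}(f(x))\setminus\mathrm{supp}(x)\bigr)$. The functor $X\mathrel{-\!\ast}(\cdot)$ is right adjoint to $(\cdot)\ast X$ with counit the evaluation $(f,x)\mapsto f(x)$; the transpose of an equivariant map $h\colon Z\ast X\to Y$ is the unique equivariant map $h^\flat\colon Z\to(X\mathrel{-\!\ast}Y)$ such that $h^\flat(z)(x)=h(z,x)$ for all $z\mathrel{\#}x$. Let $\Sigma$ and $O$ be nominal sets and let $S$ be the endofunctor $S(X)=O\times(\Sigma\mathrel{-\!\ast}X)$ of $\mathrm{Perm}\text{-}\mathbf{Nom}$. An $S$-coalgebra $(Q,\langle o,\delta^\flat\rangle)$ (a separated automaton without initial state) amounts to a nominal set $Q$ with equivariant maps $o\colon Q\to O$ and $\delta\colon Q\ast\Sigma\to Q$. Its separated language semantics $s\colon Q\ast\Sigma^{(\ast)}\to O$ is given by $$s(x,\varepsilon)=o(x),\qquad s(x,aw)=s(\delta(x,a),w)$$ for all $x\in Q$, $a\in\Sigma$, $w\in\Sigma^{(\ast)}$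 with $x\mathrel{\#}aw$ and $a\mathrel{\#}w$. **Proposition.** There is an equivariant map $\zeta\colon(\Sigma^{(\ast)}\mathrel{-\!\ast}O)\to S(\Sigma^{(\ast)}\mathrel{-\!\ast}O)$ such that $(\Sigma^{(\ast)}\mathrel{-\!\ast}O,\zeta)$ is a final $S$-coalgebra, and for every $S$-coalgebra $(Q,\langle o,\delta^\flat\rangle)$ the unique coalgebra homomorphism $Q\to(\Sigma^{(\ast)}\mathrel{-\!\ast}O)$ is the transpose $s^\flat$ of its separated language semantics $s$. -/

import Mathlib

open CategoryTheory

universe u v w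

namespace SepAut

/-! ## Finite permutations of the atoms, supports -/

/-- The group of finite permutations of `𝔸`: bijections moving only finitely many atoms. -/
def finPerm (𝔸 : Type v) : Subgroup (Equiv.Perm 𝔸) where
  carrier := {g | {a | g a ≠ a}.Finite}
  one_mem' := by simp
  mul_mem' := by
    intro g h hg hh
    refine (hg.union hh).subset ?_
    intro a ha
    by_contra hc
    simp only [Set.mem_union, Set.mem_ofPred_eq, not_or, not_not] at hc
    exact ha (by simp [hc.1, hc.2])
  inv_mem' := by
    intro g hg
    refine Set.Finite.subset hg ?_
    intro a ha hc
    exact ha (by rw [Equiv.Perm.inv_eq_iff_eq]; exact hc.symm)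

/-- The group `Perm` of finite permutations, as a type. It acts on `𝔸` by `g • a = g a`. -/
abbrev FinPerm (𝔸 : Type v) : Type v := ↥(finPerm 𝔸)

section Support

variable (𝔸 : Type v) {X : Type u} {Y : Type w}
  [MulAction (FinPerm 𝔸) X] [MulAction (FinPerm 𝔸) Y]

/-- `x` has a finite support. (`MulAction.Supports (FinPerm 𝔸) C x` says that every finite
permutation fixing `C` pointwise fixes `x`.) -/
def FinSupp (x : X) : Prop := ∃ C : Set 𝔸, C.Finite ∧ MulAction.Supports (FinPerm 𝔸) C x

/-- The support of `x`: the intersection of its finite supports. For finitely supported `x`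
this is the least finite support, see `supp_finite`, `supp_supports` and `supp_subset`. -/
def supp (x : X) : Set 𝔸 :=
  {a | ∀ C : Set 𝔸, C.Finite → MulAction.Supports (FinPerm 𝔸) C x → a ∈ C}

/-- `x` and `y` are separated: they have disjoint finite supports. -/
def Separated (x : X) (y : Y) : Prop :=
  ∃ C D : Set 𝔸, C.Finite ∧ D.Finite ∧ Disjoint C D ∧
    MulAction.Supports (FinPerm 𝔸) C x ∧ MulAction.Supports (FinPerm 𝔸) D y

end Support

/-- A nominal set: a `Perm`-set all of whose elements are finitely supported. -/
class NominalSet (𝔸 : Type v) (X : Type u) [MulAction (FinPerm 𝔸) X] : Prop where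
  finSupp : ∀ x : X, FinSupp 𝔸 x

section Lemmas

variable {𝔸 : Type v}

/-- A finite injective renaming extends to a finite permutation that moves nothing outside the
finite set and its image. -/
theorem exists_perm_extending {B : Set 𝔸} (hB : B.Finite) (j : 𝔸 → 𝔸) (hj : Set.InjOn j B) :
    ∃ g : FinPerm 𝔸, (∀ a ∈ B, g • a = j a) ∧ ∀ a, a ∉ B → a ∉ j '' B → g • a = a := by
  classical
  have hS : (B ∪ j '' B).Finite := hB.union (hB.image j)
  have : Fintype ↥(B ∪ j '' B) := hS.fintype
  let p : ↥(B ∪ j '' B) → Prop := fun a => (a : 𝔸) ∈ B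
  let q : ↥(B ∪ j '' B) → Prop := fun a => (a : 𝔸) ∈ j '' B
  let f : {x // p x} → {x // q x} := fun x =>
    ⟨⟨j x.1.1, Or.inr ⟨_, x.2, rfl⟩⟩, ⟨_, x.2, rfl⟩⟩
  have hf : Function.Bijective f := by
    constructor
    · intro x y hxy
      have : j x.1.1 = j y.1.1 := congrArg (fun z => z.1.1) hxy
      exact Subtype.ext (Subtype.ext (hj x.2 y.2 this))
    · rintro ⟨⟨y, hy⟩, hy'⟩
      obtain ⟨x, hx, hxy⟩ := hy'
      exact ⟨⟨⟨x, Or.inl hx⟩, hx⟩, Subtype.ext (Subtype.ext hxy)⟩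
  let e := Equiv.ofBijective f hf
  let σ : Equiv.Perm 𝔸 := Equiv.Perm.ofSubtype (e.extendSubtype)
  have hout : ∀ a, a ∉ B ∪ j '' B → σ a = a := fun a ha =>
    Equiv.Perm.ofSubtype_apply_of_not_mem _ ha
  have hσ : σ ∈ finPerm 𝔸 := by
    refine hS.subset ?_
    intro a ha
    by_contra hc
    exact ha (hout a hc)
  refine ⟨⟨σ, hσ⟩, ?_, ?_⟩
  · intro a ha
    change σ a = j a
    have h1 : σ a = e.extendSubtype ⟨a, Or.inl ha⟩ :=
      Equiv.Perm.ofSubtype_apply_of_mem (p := (· ∈ B ∪ j '' B)) _ (Or.inl ha)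
    rw [h1, Equiv.extendSubtype_apply_of_mem e _ (show p ⟨a, Or.inl ha⟩ from ha)]
    rfl
  · intro a ha ha'
    exact hout a (fun h => h.elim ha ha')

/-- Fresh renaming: `B \ A` can be moved away from `C` by a finite permutation fixing `A`. -/
theorem exists_fresh [Infinite 𝔸] {A B C : Set 𝔸} (hA : A.Finite) (hB : B.Finite)
    (hC : C.Finite) :
    ∃ g : FinPerm 𝔸, (∀ a ∈ A, g • a = a) ∧ ∀ a ∈ B, a ∉ A → g • a ∉ C := by
  classical
  have hinf : (A ∪ C)ᶜ.Infinite := (hA.union hC).infinite_compl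
  have : Infinite ↥(A ∪ C)ᶜ := hinf.to_subtype
  have : Countable ↥(B \ A) := hB.sdiff.countable
  have : Finite ↥(B \ A) := hB.sdiff
  obtain ⟨i⟩ : Nonempty (↥(B \ A) ↪ ↥(A ∪ C)ᶜ) := by
    obtain ⟨n, ⟨e⟩⟩ := Finite.exists_equiv_fin ↥(B \ A)
    exact ⟨e.toEmbedding.trans (Fin.valEmbedding.trans (Infinite.natEmbedding _))⟩
  let j : 𝔸 → 𝔸 := fun a => if h : a ∈ B \ A then (i ⟨a, h⟩ : 𝔸) else a
  have hj : Set.InjOn j (A ∪ B) := by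
    intro a ha b hb hab
    by_cases h1 : a ∈ B \ A <;> by_cases h2 : b ∈ B \ A <;> simp only [j, h1, h2, dif_pos,
      dif_neg, not_false_eq_true] at hab
    · exact congrArg Subtype.val (i.injective (Subtype.ext hab))
    · have : b ∈ A := by
        by_contra hc
        exact h2 ⟨hb.resolve_left hc, hc⟩
      exact absurd (Or.inl (hab ▸ this)) (i ⟨a, h1⟩).2
    · have : a ∈ A := by
        by_contra hc
        exact h1 ⟨ha.resolve_left hc, hc⟩
      exact absurd (Or.inl (hab ▸ this)) (i ⟨b, h2⟩).2
    · exact hab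
  obtain ⟨g, hg, -⟩ := exists_perm_extending (hA.union hB) j hj
  refine ⟨g, fun a ha => ?_, fun a ha ha' => ?_⟩
  · rw [hg a (Or.inl ha)]
    simp [j, ha]
  · rw [hg a (Or.inr ha)]
    have h : a ∈ B \ A := ⟨ha, ha'⟩
    simp only [j, h, dif_pos]
    exact fun hc => (i ⟨a, h⟩).2 (Or.inr hc)

variable {X : Type u} {Y : Type w} [MulAction (FinPerm 𝔸) X] [MulAction (FinPerm 𝔸) Y]

theorem supports_smul {C : Set 𝔸} {x : X} (h : MulAction.Supports (FinPerm 𝔸) C x)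
    (g : FinPerm 𝔸) : MulAction.Supports (FinPerm 𝔸) ((fun a => g • a) '' C) (g • x) := by
  intro k hk
  have : (g⁻¹ * k * g) • x = x := by
    apply h
    intro a ha
    have := hk ⟨a, ha, rfl⟩
    simp only at this
    rw [mul_smul, mul_smul, this, inv_smul_smul]
  rw [mul_smul, mul_smul, inv_smul_eq_iff] at this
  exact this

theorem supports_inter [Infinite 𝔸] {C D : Set 𝔸} (hC : C.Finite) (hD : D.Finite) {x : X}
    (h1 : MulAction.Supports (FinPerm 𝔸) C x) (h2 : MulAction.Supports (FinPerm 𝔸) D x) :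
    MulAction.Supports (FinPerm 𝔸) (C ∩ D) x := by
  intro g hg
  have hfin : {a | (g : Equiv.Perm 𝔸) a ≠ a}.Finite := g.2
  obtain ⟨k, hk, hk'⟩ := exists_fresh hC hD hfin
  have hkx : k • x = x := h1 k (fun a ha => hk a ha)
  have := supports_smul h2 k
  rw [hkx] at this
  apply this
  rintro _ ⟨a, ha, rfl⟩
  by_cases hac : a ∈ C
  · simp only [hk a hac]
    exact hg ⟨hac, ha⟩
  · have := hk' a ha hac
    by_contra hne
    exact this hne

theorem supp_subset {C : Set 𝔸} (hC : C.Finite) {x : X}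
    (h : MulAction.Supports (FinPerm 𝔸) C x) : supp 𝔸 x ⊆ C := fun _ ha => ha C hC h

theorem exists_least [Infinite 𝔸] {x : X} (hx : FinSupp 𝔸 x) :
    (supp 𝔸 x).Finite ∧ MulAction.Supports (FinPerm 𝔸) (supp 𝔸 x) x := by
  classical
  have hex : ∃ n, ∃ C : Set 𝔸, C.Finite ∧ MulAction.Supports (FinPerm 𝔸) C x ∧ C.ncard = n := by
    obtain ⟨C, h1, h2⟩ := hx
    exact ⟨_, C, h1, h2, rfl⟩
  obtain ⟨C, hC, hCs, hn⟩ := Nat.find_spec hex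
  have : supp 𝔸 x = C := by
    refine Set.Subset.antisymm (supp_subset hC hCs) ?_
    intro a ha D hD hDs
    have h1 := Nat.find_min' hex ⟨C ∩ D, hC.inter_of_left D, supports_inter hC hD hCs hDs, rfl⟩
    rw [← hn] at h1
    have := Set.eq_of_subset_of_ncard_le Set.inter_subset_left h1 hC
    rw [← this] at ha
    exact ha.2
  rw [this]
  exact ⟨hC, hCs⟩

theorem supp_finite [Infinite 𝔸] {x : X} (hx : FinSupp 𝔸 x) : (supp 𝔸 x).Finite :=
  (exists_least hx).1

theorem supp_supports [Infinite 𝔸] {x : X} (hx : FinSupp 𝔸 x) :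
    MulAction.Supports (FinPerm 𝔸) (supp 𝔸 x) x := (exists_least hx).2

theorem FinSupp.smul {x : X} (hx : FinSupp 𝔸 x) (g : FinPerm 𝔸) : FinSupp 𝔸 (g • x) := by
  obtain ⟨C, h1, h2⟩ := hx
  exact ⟨_, h1.image _, supports_smul h2 g⟩

theorem smul_mem_supp_smul {x : X} (g : FinPerm 𝔸) {a : 𝔸} (ha : a ∈ supp 𝔸 x) :
    g • a ∈ supp 𝔸 (g • x) := by
  intro C hC hCs
  have := supports_smul hCs g⁻¹
  rw [inv_smul_smul] at this
  obtain ⟨b, hb, hab⟩ := ha _ (hC.image _) this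
  simp only at hab
  rw [← hab, smul_inv_smul]
  exact hb

theorem mem_supp_smul {x : X} (g : FinPerm 𝔸) {a : 𝔸} :
    a ∈ supp 𝔸 (g • x) ↔ g⁻¹ • a ∈ supp 𝔸 x := by
  constructor
  · intro h
    simpa using smul_mem_supp_smul g⁻¹ h
  · intro h
    simpa using smul_mem_supp_smul g h

theorem smul_eq_of_fix [Infinite 𝔸] {x : X} (hx : FinSupp 𝔸 x) {g : FinPerm 𝔸}
    (h : ∀ a ∈ supp 𝔸 x, g • a = a) : g • x = x := supp_supports hx g (fun a ha => h a ha)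

theorem smul_eq_smul_of [Infinite 𝔸] {x : X} (hx : FinSupp 𝔸 x) {g k : FinPerm 𝔸}
    (h : ∀ a ∈ supp 𝔸 x, g • a = k • a) : g • x = k • x := by
  rw [← inv_smul_eq_iff, ← mul_smul]
  apply smul_eq_of_fix hx
  intro a ha
  rw [mul_smul, h a ha, inv_smul_smul]

theorem separated_iff [Infinite 𝔸] {x : X} {y : Y} (hx : FinSupp 𝔸 x) (hy : FinSupp 𝔸 y) :
    Separated 𝔸 x y ↔ Disjoint (supp 𝔸 x) (supp 𝔸 y) := by
  constructor
  · rintro ⟨C, D, hC, hD, h, h1, h2⟩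
    exact h.mono (supp_subset hC h1) (supp_subset hD h2)
  · intro h
    exact ⟨_, _, supp_finite hx, supp_finite hy, h, supp_supports hx, supp_supports hy⟩

theorem Separated.smul {x : X} {y : Y} (h : Separated 𝔸 x y) (g : FinPerm 𝔸) :
    Separated 𝔸 (g • x) (g • y) := by
  obtain ⟨C, D, hC, hD, h, h1, h2⟩ := h
  exact ⟨_, _, hC.image _, hD.image _,
    (Set.disjoint_image_iff (MulAction.injective g)).2 h, supports_smul h1 g, supports_smul h2 g⟩

theorem Separated.symm {x : X} {y : Y} (h : Separated 𝔸 x y) : Separated 𝔸 y x := by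
  obtain ⟨C, D, hC, hD, h, h1, h2⟩ := h
  exact ⟨D, C, hD, hC, h.symm, h2, h1⟩

theorem supports_map {C : Set 𝔸} {x : X} (h : MulAction.Supports (FinPerm 𝔸) C x)
    (f : X →[FinPerm 𝔸] Y) : MulAction.Supports (FinPerm 𝔸) C (f x) := by
  intro g hg
  rw [← map_smul, h g hg]

theorem Separated.map_left {Z : Type*} [MulAction (FinPerm 𝔸) Z] {x : X} {z : Z}
    (h : Separated 𝔸 x z) (f : X →[FinPerm 𝔸] Y) : Separated 𝔸 (f x) z := by
  obtain ⟨C, D, hC, hD, h, h1, h2⟩ := h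
  exact ⟨C, D, hC, hD, h, supports_map h1 f, h2⟩

end Lemmas

/-! ## Products and separated products -/

instance (𝔸 : Type v) (X : Type u) (Y : Type w) [MulAction (FinPerm 𝔸) X]
    [MulAction (FinPerm 𝔸) Y] [NominalSet 𝔸 X] [NominalSet 𝔸 Y] : NominalSet 𝔸 (X × Y) where
  finSupp := by
    rintro ⟨x, y⟩
    obtain ⟨C, hC, hCs⟩ := NominalSet.finSupp (𝔸 := 𝔸) x
    obtain ⟨D, hD, hDs⟩ := NominalSet.finSupp (𝔸 := 𝔸) y
    refine ⟨C ∪ D, hC.union hD, fun g hg => Prod.ext ?_ ?_⟩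
    · exact hCs g (fun a ha => hg (Or.inl ha))
    · exact hDs g (fun a ha => hg (Or.inr ha))

/-- The separated product `X ∗ Y`, with the pointwise action. -/
def SepProd (𝔸 : Type v) (X : Type u) (Y : Type w) [MulAction (FinPerm 𝔸) X]
    [MulAction (FinPerm 𝔸) Y] : Type (max u w) :=
  {p : X × Y // Separated 𝔸 p.1 p.2}

section SepProd

variable {𝔸 : Type v} {X : Type u} {Y : Type w} [MulAction (FinPerm 𝔸) X]
  [MulAction (FinPerm 𝔸) Y]

instance : MulAction (FinPerm 𝔸) (SepProd 𝔸 X Y) where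
  smul g p := ⟨g • p.1, p.2.smul g⟩
  one_smul p := Subtype.ext (one_smul _ p.1)
  mul_smul g h p := Subtype.ext (mul_smul g h p.1)

/-- The pair `(x, y)` as an element of the separated product. -/
def SepProd.mk (x : X) (y : Y) (h : Separated 𝔸 x y) : SepProd 𝔸 X Y := ⟨(x, y), h⟩

theorem SepProd.smul_mk (g : FinPerm 𝔸) (x : X) (y : Y) (h : Separated 𝔸 x y) :
    g • SepProd.mk x y h = SepProd.mk (g • x) (g • y) (h.smul g) := rfl

instance [NominalSet 𝔸 X] [NominalSet 𝔸 Y] : NominalSet 𝔸 (SepProd 𝔸 X Y) where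
  finSupp := by
    rintro ⟨p, hp⟩
    obtain ⟨C, hC, hCs⟩ := NominalSet.finSupp (𝔸 := 𝔸) p
    exact ⟨C, hC, fun g hg => Subtype.ext (hCs g hg)⟩

/-- If `x # z` and `y # z` then `f (x, y) # z` for equivariant `f` on the separated product. -/
theorem separated_apply [Infinite 𝔸] {Z T : Type*} [MulAction (FinPerm 𝔸) Z]
    [MulAction (FinPerm 𝔸) T]
    [NominalSet 𝔸 X] [NominalSet 𝔸 Y] [NominalSet 𝔸 Z] (f : SepProd 𝔸 X Y →[FinPerm 𝔸] T)
    {x : X} {y : Y} {z : Z} (h : Separated 𝔸 x y) (h1 : Separated 𝔸 x z)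
    (h2 : Separated 𝔸 y z) : Separated 𝔸 (f (SepProd.mk x y h)) z := by
  have fx := NominalSet.finSupp (𝔸 := 𝔸) x
  have fy := NominalSet.finSupp (𝔸 := 𝔸) y
  have fz := NominalSet.finSupp (𝔸 := 𝔸) z
  rw [separated_iff fx fz] at h1
  rw [separated_iff fy fz] at h2
  refine ⟨supp 𝔸 x ∪ supp 𝔸 y, supp 𝔸 z, (supp_finite fx).union (supp_finite fy),
    supp_finite fz, Set.disjoint_union_left.2 ⟨h1, h2⟩, ?_, supp_supports fz⟩
  apply supports_map
  intro g hg
  rw [SepProd.smul_mk]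
  exact Subtype.ext (Prod.ext (smul_eq_of_fix fx fun a ha => hg (Or.inl ha))
    (smul_eq_of_fix fy fun a ha => hg (Or.inr ha)))

end SepProd

/-! ## Separated words -/

section Words

variable {𝔸 : Type v} {X : Type u} [MulAction (FinPerm 𝔸) X]

/-- Words carry the letterwise action. -/
instance : MulAction (FinPerm 𝔸) (List X) where
  smul g l := l.map (g • ·)
  one_smul l := by
    change l.map _ = l
    simp
  mul_smul g h l := by
    change l.map _ = (l.map _).map _
    simp [mul_smul]

theorem smul_nil (g : FinPerm 𝔸) : g • ([] : List X) = [] := rfl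

theorem smul_cons (g : FinPerm 𝔸) (a : X) (l : List X) : g • (a :: l) = g • a :: g • l := rfl

theorem smul_append (g : FinPerm 𝔸) (l l' : List X) : g • (l ++ l') = g • l ++ g • l' :=
  List.map_append

instance [NominalSet 𝔸 X] : NominalSet 𝔸 (List X) where
  finSupp := by
    intro l
    induction l with
    | nil => exact ⟨∅, Set.finite_empty, fun g _ => rfl⟩
    | cons a l ih =>
      obtain ⟨C, hC, hCs⟩ := NominalSet.finSupp (𝔸 := 𝔸) a
      obtain ⟨D, hD, hDs⟩ := ih
      refine ⟨C ∪ D, hC.union hD, fun g hg => ?_⟩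
      rw [smul_cons, hCs g (fun a ha => hg (Or.inl ha)), hDs g (fun a ha => hg (Or.inr ha))]

variable (𝔸) in
/-- The separated words: the empty word is in the power `X^(0)`, and `w x` is in `X^(n+1)` iff
`w` is in `X^(n)` and `w # x`. -/
inductive IsSepWord : List X → Prop
  | nil : IsSepWord []
  | snoc {w : List X} {x : X} : IsSepWord w → Separated 𝔸 w x → IsSepWord (w ++ [x])

theorem IsSepWord.smul {w : List X} (h : IsSepWord 𝔸 w) (g : FinPerm 𝔸) :
    IsSepWord 𝔸 (g • w) := by
  induction h with
  | nil => exact IsSepWord.nil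
  | snoc _ hx ih =>
    rw [smul_append]
    exact IsSepWord.snoc ih (hx.smul g)

variable (𝔸 X) in
/-- The set `X^(*)` of separated words, i.e. the union of the separated powers `X^(n)`. -/
def SepWord : Type u := {l : List X // IsSepWord 𝔸 l}

instance : MulAction (FinPerm 𝔸) (SepWord 𝔸 X) where
  smul g l := ⟨g • l.1, l.2.smul g⟩
  one_smul l := Subtype.ext (one_smul _ l.1)
  mul_smul g h l := Subtype.ext (mul_smul g h l.1)

instance [NominalSet 𝔸 X] : NominalSet 𝔸 (SepWord 𝔸 X) where
  finSupp := by
    rintro ⟨p, hp⟩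
    obtain ⟨C, hC, hCs⟩ := NominalSet.finSupp (𝔸 := 𝔸) p
    exact ⟨C, hC, fun g hg => Subtype.ext (hCs g hg)⟩

theorem separated_sepWord {Y : Type w} [MulAction (FinPerm 𝔸) Y] {y : Y} {l : SepWord 𝔸 X} :
    Separated 𝔸 y l ↔ Separated 𝔸 y l.1 := by
  constructor
  · rintro ⟨C, D, hC, hD, h, h1, h2⟩
    exact ⟨C, D, hC, hD, h, h1, fun g hg => congrArg Subtype.val (h2 g hg)⟩
  · rintro ⟨C, D, hC, hD, h, h1, h2⟩
    exact ⟨C, D, hC, hD, h, h1, fun g hg => Subtype.ext (h2 g hg)⟩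

theorem separated_cons_iff [Infinite 𝔸] [NominalSet 𝔸 X] {Y : Type w} [MulAction (FinPerm 𝔸) Y]
    [NominalSet 𝔸 Y] {y : Y} {a : X} {l : List X} :
    Separated 𝔸 y (a :: l) ↔ Separated 𝔸 y a ∧ Separated 𝔸 y l := by
  constructor
  · rintro ⟨C, D, hC, hD, h, h1, h2⟩
    refine ⟨⟨C, D, hC, hD, h, h1, fun g hg => ?_⟩, ⟨C, D, hC, hD, h, h1, fun g hg => ?_⟩⟩
    · exact (List.cons_eq_cons.1 (h2 g hg)).1
    · exact (List.cons_eq_cons.1 (h2 g hg)).2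
  · rintro ⟨h1, h2⟩
    have fy := NominalSet.finSupp (𝔸 := 𝔸) y
    have fa := NominalSet.finSupp (𝔸 := 𝔸) a
    have fl := NominalSet.finSupp (𝔸 := 𝔸) l
    rw [separated_iff fy fa] at h1
    rw [separated_iff fy fl] at h2
    refine ⟨_, supp 𝔸 a ∪ supp 𝔸 l, supp_finite fy, (supp_finite fa).union (supp_finite fl),
      Set.disjoint_union_right.2 ⟨h1, h2⟩, supp_supports fy, fun g hg => ?_⟩
    rw [smul_cons, smul_eq_of_fix fa fun b hb => hg (Or.inl hb),
      smul_eq_of_fix fl fun b hb => hg (Or.inr hb)]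

theorem separated_list_iff [Infinite 𝔸] [NominalSet 𝔸 X] {Y : Type w} [MulAction (FinPerm 𝔸) Y]
    [NominalSet 𝔸 Y] {y : Y} {l : List X} :
    Separated 𝔸 y l ↔ ∀ a ∈ l, Separated 𝔸 y a := by
  induction l with
  | nil =>
    simp only [List.not_mem_nil, false_imp_iff, implies_true, iff_true]
    obtain ⟨C, hC, hCs⟩ := NominalSet.finSupp (𝔸 := 𝔸) y
    exact ⟨C, ∅, hC, Set.finite_empty, Set.disjoint_empty C, hCs, fun g _ => rfl⟩
  | cons a l ih => rw [separated_cons_iff, ih, List.forall_mem_cons]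

theorem isSepWord_iff_pairwise [Infinite 𝔸] [NominalSet 𝔸 X] {l : List X} :
    IsSepWord 𝔸 l ↔ l.Pairwise (Separated 𝔸) := by
  constructor
  · intro h
    induction h with
    | nil => exact List.Pairwise.nil
    | snoc _ hx ih =>
      refine List.pairwise_append.2 ⟨ih, List.pairwise_singleton _ _, fun a ha b hb => ?_⟩
      rw [List.mem_singleton.1 hb]
      exact (separated_list_iff.1 hx.symm a ha).symm
  · induction l using List.reverseRecOn with
    | nil => exact fun _ => IsSepWord.nil
    | append_singleton l x ih =>
      intro h
      rw [List.pairwise_append] at h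
      exact IsSepWord.snoc (ih h.1)
        (separated_list_iff.2 fun a ha => (h.2.2 a ha x (by simp)).symm).symm

theorem isSepWord_cons_iff [Infinite 𝔸] [NominalSet 𝔸 X] {a : X} {l : List X} :
    IsSepWord 𝔸 (a :: l) ↔ Separated 𝔸 a l ∧ IsSepWord 𝔸 l := by
  rw [isSepWord_iff_pairwise, isSepWord_iff_pairwise, List.pairwise_cons, separated_list_iff]

end Words

/-! ## The magic wand -/

/-- Partial functions from `X` to `Y`; `none` means undefined. -/
def PartialFun (X : Type u) (Y : Type w) : Type (max u w) := X → Option Y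

section Wand

variable {𝔸 : Type v} {X : Type u} {Y : Type w} [MulAction (FinPerm 𝔸) X]
  [MulAction (FinPerm 𝔸) Y]

/-- The action on partial functions: `(g • f) x = g • f (g⁻¹ • x)` if `f (g⁻¹ • x)` is
defined. -/
instance : MulAction (FinPerm 𝔸) (PartialFun X Y) where
  smul g f := fun x => (f (g⁻¹ • x)).map (g • ·)
  one_smul f := by
    funext x
    change (f ((1 : FinPerm 𝔸)⁻¹ • x)).map _ = f x
    simp
  mul_smul g h f := by
    funext x
    change (f ((g * h)⁻¹ • x)).map _ = ((f (h⁻¹ • g⁻¹ • x)).map _).map _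
    simp only [mul_inv_rev, mul_smul, Option.map_map]
    rfl

theorem PartialFun.smul_apply (g : FinPerm 𝔸) (f : PartialFun X Y) (x : X) :
    (g • f) x = (f (g⁻¹ • x)).map (g • ·) := rfl

theorem PartialFun.smul_apply_smul (g : FinPerm 𝔸) (f : PartialFun X Y) (x : X) :
    (g • f) (g • x) = (f x).map (g • ·) := by
  rw [PartialFun.smul_apply, inv_smul_smul]

variable (𝔸) in
/-- A partial function `f` is separating if it is finitely supported, `f x` is defined iff
`f # x`, and the support of `f` is the union of the sets `supp (f x) \ supp x` for `x` in the
domain of `f`. -/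
structure IsSeparating (f : PartialFun X Y) : Prop where
  finSupp : FinSupp 𝔸 f
  dom_iff : ∀ x, (f x).isSome ↔ Separated 𝔸 f x
  supp_eq : supp 𝔸 f = {a | ∃ x y, f x = some y ∧ a ∈ supp 𝔸 y \ supp 𝔸 x}

theorem IsSeparating.smul {f : PartialFun X Y} (h : IsSeparating 𝔸 f) (g : FinPerm 𝔸) :
    IsSeparating 𝔸 (g • f) where
  finSupp := h.finSupp.smul g
  dom_iff x := by
    rw [PartialFun.smul_apply, Option.isSome_map, h.dom_iff]
    constructor
    · intro hs
      simpa using hs.smul g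
    · intro hs
      simpa using hs.smul g⁻¹
  supp_eq := by
    ext a
    rw [mem_supp_smul, h.supp_eq]
    constructor
    · rintro ⟨x, y, hxy, h1, h2⟩
      refine ⟨g • x, g • y, ?_, ?_, ?_⟩
      · rw [PartialFun.smul_apply_smul, hxy]
        rfl
      · rwa [mem_supp_smul]
      · rwa [mem_supp_smul]
    · rintro ⟨x, y, hxy, h1, h2⟩
      rw [PartialFun.smul_apply, Option.map_eq_some_iff] at hxy
      obtain ⟨y', hy', rfl⟩ := hxy
      refine ⟨g⁻¹ • x, y', hy', ?_, ?_⟩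
      · rwa [mem_supp_smul] at h1
      · rw [mem_supp_smul]
        simpa using h2

variable (𝔸 X Y) in
/-- The magic wand `X −∗ Y`: the nominal set of separating partial functions. -/
def Wand : Type (max u w) := {f : PartialFun X Y // IsSeparating 𝔸 f}

instance : MulAction (FinPerm 𝔸) (Wand 𝔸 X Y) where
  smul g f := ⟨g • f.1, f.2.smul g⟩
  one_smul f := Subtype.ext (one_smul _ f.1)
  mul_smul g h f := Subtype.ext (mul_smul g h f.1)

instance : NominalSet 𝔸 (Wand 𝔸 X Y) where
  finSupp := by
    rintro ⟨f, hf⟩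
    obtain ⟨C, hC, hCs⟩ := hf.finSupp
    exact ⟨C, hC, fun g hg => Subtype.ext (hCs g hg)⟩

theorem separated_wand {Z : Type*} [MulAction (FinPerm 𝔸) Z] {f : Wand 𝔸 X Y} {z : Z} :
    Separated 𝔸 f z ↔ Separated 𝔸 f.1 z := by
  constructor
  · rintro ⟨C, D, hC, hD, h, h1, h2⟩
    exact ⟨C, D, hC, hD, h, fun g hg => congrArg Subtype.val (h1 g hg), h2⟩
  · rintro ⟨C, D, hC, hD, h, h1, h2⟩
    exact ⟨C, D, hC, hD, h, fun g hg => Subtype.ext (h1 g hg), h2⟩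

theorem Wand.isSome (p : SepProd 𝔸 (Wand 𝔸 X Y) X) : (p.1.1.1 p.1.2).isSome :=
  (p.1.1.2.dom_iff _).2 (separated_wand.1 p.2)

variable (𝔸 X Y) in
/-- Evaluation `(X −∗ Y) ∗ X → Y`, `(f, x) ↦ f x`. -/
def Wand.eval : SepProd 𝔸 (Wand 𝔸 X Y) X →[FinPerm 𝔸] Y where
  toFun p := (p.1.1.1 p.1.2).get (Wand.isSome p)
  map_smul' g p := by
    apply Option.some_injective
    rw [Option.some_get]
    change (g • p.1.1.1) (g • p.1.2) = some (g • _)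
    rw [PartialFun.smul_apply_smul, ← Option.map_some, Option.some_get]

theorem Wand.some_eval (f : Wand 𝔸 X Y) (x : X) (h : Separated 𝔸 f x) :
    some (Wand.eval 𝔸 X Y (SepProd.mk f x h)) = f.1 x := Option.some_get _

theorem supp_subset_of_apply [Infinite 𝔸] [NominalSet 𝔸 X] {f : PartialFun X Y}
    (hf : FinSupp 𝔸 f) {x : X} {y : Y} (h : f x = some y) :
    supp 𝔸 y ⊆ supp 𝔸 f ∪ supp 𝔸 x := by
  have fx := NominalSet.finSupp (𝔸 := 𝔸) x
  refine supp_subset ((supp_finite hf).union (supp_finite fx)) ?_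
  intro g hg
  have h1 : g • f = f := smul_eq_of_fix hf fun a ha => hg (Or.inl ha)
  have h2 : g • x = x := smul_eq_of_fix fx fun a ha => hg (Or.inr ha)
  have := PartialFun.smul_apply_smul g f x
  rw [h1, h2, h] at this
  exact (Option.some_injective _ this).symm

/-- Separating functions that agree on all sufficiently fresh arguments are equal. -/
theorem Wand.ext_fresh [Infinite 𝔸] [NominalSet 𝔸 X] {f f' : Wand 𝔸 X Y} {C : Set 𝔸}
    (hC : C.Finite) (h : ∀ x, Disjoint C (supp 𝔸 x) → f.1 x = f'.1 x) : f = f' := by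
  have key : ∀ (k : Wand 𝔸 X Y) (x : X), Separated 𝔸 k.1 x →
      ∃ g : FinPerm 𝔸, (∀ a ∈ supp 𝔸 k.1, g • a = a) ∧ Disjoint C (supp 𝔸 (g • x)) ∧
        g • k.1 = k.1 := by
    intro k x hkx
    have fx := NominalSet.finSupp (𝔸 := 𝔸) x
    rw [separated_iff k.2.finSupp fx] at hkx
    obtain ⟨g, hg, hg'⟩ := exists_fresh (supp_finite k.2.finSupp) (supp_finite fx) hC
    refine ⟨g, hg, ?_, smul_eq_of_fix k.2.finSupp hg⟩
    rw [Set.disjoint_right]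
    intro a ha
    rw [mem_supp_smul] at ha
    have := hg' _ ha (Set.disjoint_right.1 hkx ha)
    rwa [smul_inv_smul] at this
  have sub : ∀ k k' : Wand 𝔸 X Y, (∀ x, Disjoint C (supp 𝔸 x) → k.1 x = k'.1 x) →
      supp 𝔸 k.1 ⊆ supp 𝔸 k'.1 := by
    intro k k' hkk a ha
    have ha' := ha
    rw [k.2.supp_eq] at ha'
    obtain ⟨x, y, hxy, h1, h2⟩ := ha'
    obtain ⟨g, hg, hgC, hgk⟩ := key k x ((k.2.dom_iff x).1 (by simp [hxy]))
    rw [k'.2.supp_eq]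
    have hga : g⁻¹ • a = a := by rw [inv_smul_eq_iff, hg a ha]
    refine ⟨g • x, g • y, ?_, ?_, ?_⟩
    · rw [← hkk _ hgC, ← hgk, PartialFun.smul_apply_smul, hxy]
      rfl
    · rwa [mem_supp_smul, hga]
    · rwa [mem_supp_smul, hga]
  have hs : supp 𝔸 f.1 = supp 𝔸 f'.1 :=
    Set.Subset.antisymm (sub f f' h) (sub f' f fun x hx => (h x hx).symm)
  refine Subtype.ext (funext fun x => ?_)
  have fx := NominalSet.finSupp (𝔸 := 𝔸) x
  by_cases hx : Separated 𝔸 f.1 x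
  · obtain ⟨g, hg, hgC, hgk⟩ := key f x hx
    have hgk' : g • f'.1 = f'.1 := smul_eq_of_fix f'.2.finSupp (hs ▸ hg)
    have h1 := PartialFun.smul_apply_smul g f.1 x
    have h2 := PartialFun.smul_apply_smul g f'.1 x
    rw [hgk, h _ hgC] at h1
    rw [hgk', h1] at h2
    exact Option.map_injective (MulAction.injective g) h2
  · have hx' : ¬ Separated 𝔸 f'.1 x := by
      rwa [separated_iff f'.2.finSupp fx, ← hs, ← separated_iff f.2.finSupp fx]
    rw [← f.2.dom_iff, Option.not_isSome_iff_eq_none] at hx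
    rw [← f'.2.dom_iff, Option.not_isSome_iff_eq_none] at hx'
    rw [hx, hx']

end Wand

/-! ## Transposition -/

section Curry

variable {𝔸 : Type v} {Z : Type*} {X : Type u} {Y : Type w} [MulAction (FinPerm 𝔸) Z]
  [MulAction (FinPerm 𝔸) X] [MulAction (FinPerm 𝔸) Y]
  (h : SepProd 𝔸 Z X →[FinPerm 𝔸] Y)

/-- The support of the transpose of `h` at `z`, see `supp_curryFun`. -/
def residual (z : Z) : Set 𝔸 :=
  {a | ∃ x, ∃ H : Separated 𝔸 z x, a ∈ supp 𝔸 (h (SepProd.mk z x H)) \ supp 𝔸 x}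

open Classical in
/-- The transpose of `h` at `z`: the partial function sending `x` to `h (g • z, x)` for any `g`
that fixes `residual h z` pointwise and such that `g • z # x`. -/
noncomputable def curryFun (z : Z) : PartialFun X Y := fun x =>
  if H : ∃ g : FinPerm 𝔸, (∀ a ∈ residual h z, g • a = a) ∧ Separated 𝔸 (g • z) x then
    some (h (SepProd.mk (H.choose • z) x H.choose_spec.2))
  else none

theorem residual_smul (g : FinPerm 𝔸) (z : Z) (a : 𝔸) :
    a ∈ residual h (g • z) ↔ g⁻¹ • a ∈ residual h z := by
  have key : ∀ (g : FinPerm 𝔸) (z : Z) (a : 𝔸), a ∈ residual h z →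
      g • a ∈ residual h (g • z) := by
    rintro g z a ⟨x, H, h1, h2⟩
    refine ⟨g • x, H.smul g, ?_, ?_⟩
    · rw [← SepProd.smul_mk, map_smul, mem_supp_smul, inv_smul_smul]
      exact h1
    · rwa [mem_supp_smul, inv_smul_smul]
  constructor
  · intro ha
    simpa using key g⁻¹ _ _ ha
  · intro ha
    simpa using key g _ _ ha

variable [Infinite 𝔸] [NominalSet 𝔸 Z] [NominalSet 𝔸 X]

theorem supp_apply_subset (z : Z) (x : X) (H : Separated 𝔸 z x) :
    supp 𝔸 (h (SepProd.mk z x H)) ⊆ supp 𝔸 z ∪ supp 𝔸 x := by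
  have fz := NominalSet.finSupp (𝔸 := 𝔸) z
  have fx := NominalSet.finSupp (𝔸 := 𝔸) x
  refine supp_subset ((supp_finite fz).union (supp_finite fx)) (supports_map ?_ h)
  intro g hg
  rw [SepProd.smul_mk]
  exact Subtype.ext (Prod.ext (smul_eq_of_fix fz fun a ha => hg (Or.inl ha))
    (smul_eq_of_fix fx fun a ha => hg (Or.inr ha)))

theorem finSupp_apply (z : Z) (x : X) (H : Separated 𝔸 z x) :
    FinSupp 𝔸 (h (SepProd.mk z x H)) := by
  obtain ⟨C, hC, hCs⟩ := NominalSet.finSupp (𝔸 := 𝔸) (SepProd.mk z x H)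
  exact ⟨C, hC, supports_map hCs h⟩

theorem residual_subset (z : Z) : residual h z ⊆ supp 𝔸 z := by
  rintro a ⟨x, H, h1, h2⟩
  exact (supp_apply_subset h z x H h1).resolve_right h2

theorem residual_finite (z : Z) : (residual h z).Finite :=
  (supp_finite (NominalSet.finSupp z)).subset (residual_subset h z)

theorem residual_smul_of_fix {z : Z} {g : FinPerm 𝔸} (hg : ∀ a ∈ residual h z, g • a = a) :
    residual h (g • z) = residual h z := by
  have hfin := residual_finite h z
  have himg : residual h (g • z) = (fun a => g • a) '' residual h z := by
    ext a
    rw [residual_smul]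
    constructor
    · intro ha
      exact ⟨_, ha, smul_inv_smul g a⟩
    · rintro ⟨b, hb, rfl⟩
      simpa using hb
  rw [himg]
  ext a
  constructor
  · rintro ⟨b, hb, rfl⟩
    simpa only [hg b hb] using hb
  · intro ha
    exact ⟨a, ha, hg a ha⟩

/-- The value of the transpose does not depend on the choice of the renaming. -/
theorem curry_wd (z : Z) (x : X) {g k : FinPerm 𝔸}
    (hg : ∀ a ∈ residual h z, g • a = a) (hgx : Separated 𝔸 (g • z) x)
    (hk : ∀ a ∈ residual h z, k • a = a) (hkx : Separated 𝔸 (k • z) x) :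
    h (SepProd.mk (g • z) x hgx) = h (SepProd.mk (k • z) x hkx) := by
  have fz : FinSupp 𝔸 z := NominalSet.finSupp z
  have fgz : FinSupp 𝔸 (g • z) := NominalSet.finSupp _
  have fkz : FinSupp 𝔸 (k • z) := NominalSet.finSupp _
  have fx : FinSupp 𝔸 x := NominalSet.finSupp x
  have hdg := (separated_iff fgz fx).1 hgx
  have hdk := (separated_iff fkz fx).1 hkx
  obtain ⟨r, hr, hr'⟩ := exists_perm_extending (supp_finite fgz)
    (fun a => (k * g⁻¹) • a) (MulAction.injective (k * g⁻¹)).injOn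
  have hrz : r • g • z = k • z := by
    rw [smul_eq_smul_of fgz (k := k * g⁻¹) (fun a ha => hr a ha), mul_smul, inv_smul_smul]
  have hrx : r • x = x := by
    refine smul_eq_of_fix fx fun a ha => hr' a (Set.disjoint_right.1 hdg ha) ?_
    rintro ⟨b, hb, rfl⟩
    refine Set.disjoint_right.1 hdk ha ?_
    rw [mem_supp_smul] at hb ⊢
    simpa [mul_smul] using hb
  have hrA : ∀ a ∈ residual h z, r • a = a := by
    intro a ha
    have h1 : a ∈ supp 𝔸 (g • z) :=
      residual_subset h _ ((residual_smul_of_fix h hg).symm ▸ ha)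
    rw [hr a h1]
    simp only [mul_smul]
    rw [(inv_smul_eq_iff (g := g)).2 (hg a ha).symm, hk a ha]
  have hfix : r • h (SepProd.mk (g • z) x hgx) = h (SepProd.mk (g • z) x hgx) := by
    refine smul_eq_of_fix (finSupp_apply h _ _ _) fun a ha => ?_
    by_cases hax : a ∈ supp 𝔸 x
    · refine hr' a (Set.disjoint_right.1 hdg hax) ?_
      rintro ⟨b, hb, rfl⟩
      refine Set.disjoint_right.1 hdk hax ?_
      rw [mem_supp_smul] at hb ⊢
      simpa [mul_smul] using hb
    · apply hrA
      rw [← residual_smul_of_fix h hg]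
      exact ⟨x, hgx, ha, hax⟩
  rw [← hfix, ← map_smul, SepProd.smul_mk]
  congr 1
  exact Subtype.ext (Prod.ext hrz hrx)

theorem curryFun_eq (z : Z) (x : X) {g : FinPerm 𝔸}
    (hg : ∀ a ∈ residual h z, g • a = a) (hgx : Separated 𝔸 (g • z) x) :
    curryFun h z x = some (h (SepProd.mk (g • z) x hgx)) := by
  have H : ∃ g : FinPerm 𝔸, (∀ a ∈ residual h z, g • a = a) ∧ Separated 𝔸 (g • z) x :=
    ⟨g, hg, hgx⟩
  simp only [curryFun, dif_pos H]
  exact congrArg some (curry_wd h z x H.choose_spec.1 H.choose_spec.2 hg hgx)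

theorem curryFun_eq_some_iff (z : Z) (x : X) (y : Y) :
    curryFun h z x = some y ↔ ∃ g : FinPerm 𝔸, (∀ a ∈ residual h z, g • a = a) ∧
      ∃ H : Separated 𝔸 (g • z) x, h (SepProd.mk (g • z) x H) = y := by
  constructor
  · intro hy
    by_cases H : ∃ g : FinPerm 𝔸, (∀ a ∈ residual h z, g • a = a) ∧ Separated 𝔸 (g • z) x
    · obtain ⟨g, hg, hgx⟩ := H
      rw [curryFun_eq h z x hg hgx] at hy
      exact ⟨g, hg, hgx, Option.some_injective _ hy⟩
    · simp [curryFun, dif_neg H] at hy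
  · rintro ⟨g, hg, hgx, rfl⟩
    exact curryFun_eq h z x hg hgx

theorem curryFun_apply (z : Z) (x : X) (H : Separated 𝔸 z x) :
    curryFun h z x = some (h (SepProd.mk z x H)) := by
  have H' : Separated 𝔸 ((1 : FinPerm 𝔸) • z) x := by rwa [one_smul]
  rw [curryFun_eq h z x (g := 1) (fun a _ => one_smul _ a) H']
  simp only [one_smul]

theorem curryFun_isSome_iff (z : Z) (x : X) :
    (curryFun h z x).isSome ↔ Disjoint (residual h z) (supp 𝔸 x) := by
  have fx : FinSupp 𝔸 x := NominalSet.finSupp x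
  have fz : FinSupp 𝔸 z := NominalSet.finSupp z
  rw [Option.isSome_iff_exists]
  constructor
  · rintro ⟨y, hy⟩
    obtain ⟨g, hg, H, -⟩ := (curryFun_eq_some_iff h z x y).1 hy
    rw [separated_iff (fz.smul g) fx] at H
    rw [← residual_smul_of_fix h hg]
    exact H.mono_left (residual_subset h _)
  · intro hd
    obtain ⟨g, hg, hg'⟩ := exists_fresh (residual_finite h z) (supp_finite fz) (supp_finite fx)
    refine ⟨_, curryFun_eq h z x hg ?_⟩
    rw [separated_iff (fz.smul g) fx, Set.disjoint_left]
    intro a ha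
    rw [mem_supp_smul] at ha
    by_cases har : g⁻¹ • a ∈ residual h z
    · have h1 := hg _ har
      rw [smul_inv_smul] at h1
      rw [← h1] at har
      exact Set.disjoint_left.1 hd har
    · simpa using hg' _ ha har

theorem curryFun_smul (g : FinPerm 𝔸) (z : Z) : curryFun h (g • z) = g • curryFun h z := by
  have key : ∀ (g : FinPerm 𝔸) (z : Z) (x : X) (y : Y), curryFun h z x = some y →
      curryFun h (g • z) (g • x) = some (g • y) := by
    intro g z x y hy
    rw [curryFun_eq_some_iff] at hy ⊢
    obtain ⟨k, hk, H, rfl⟩ := hy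
    have e : (g * k * g⁻¹) • g • z = g • k • z := by simp [mul_smul]
    refine ⟨g * k * g⁻¹, ?_, ?_, ?_⟩
    · intro a ha
      rw [residual_smul] at ha
      rw [mul_smul, mul_smul, hk _ ha, smul_inv_smul]
    · rw [e]
      exact H.smul g
    · rw [← map_smul, SepProd.smul_mk]
      congr 1
      exact Subtype.ext (Prod.ext e rfl)
  funext x
  rw [PartialFun.smul_apply]
  ext y
  rw [Option.map_eq_some_iff]
  constructor
  · intro hy
    have := key g⁻¹ _ _ _ hy
    rw [inv_smul_smul] at this
    exact ⟨_, this, smul_inv_smul g y⟩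
  · rintro ⟨y', hy', rfl⟩
    simpa using key g _ _ _ hy'

theorem curryFun_supports (z : Z) :
    MulAction.Supports (FinPerm 𝔸) (residual h z) (curryFun h z) := by
  intro g hg
  rw [← curryFun_smul]
  funext x
  have hr := residual_smul_of_fix h (fun a ha => hg ha : ∀ a ∈ residual h z, g • a = a)
  have key : ∀ y, curryFun h (g • z) x = some y → curryFun h z x = some y := by
    intro y hy
    rw [curryFun_eq_some_iff] at hy ⊢
    obtain ⟨k, hk, H, rfl⟩ := hy
    rw [hr] at hk
    refine ⟨k * g, fun a ha => ?_, ?_, ?_⟩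
    · rw [mul_smul, hg ha, hk a ha]
    · rw [mul_smul]
      exact H
    · simp only [mul_smul]
  cases hc : curryFun h (g • z) x with
  | some y => rw [key y hc]
  | none =>
    rw [eq_comm, ← Option.not_isSome_iff_eq_none, curryFun_isSome_iff, ← hr,
      ← curryFun_isSome_iff, hc]
    simp

theorem curryFun_finSupp (z : Z) : FinSupp 𝔸 (curryFun h z) :=
  ⟨_, residual_finite h z, curryFun_supports h z⟩

theorem supp_curryFun (z : Z) : supp 𝔸 (curryFun h z) = residual h z := by
  refine Set.Subset.antisymm (supp_subset (residual_finite h z) (curryFun_supports h z)) ?_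
  rintro a ⟨x, H, h1, h2⟩
  exact (supp_subset_of_apply (curryFun_finSupp h z) (curryFun_apply h z x H) h1).resolve_right h2

theorem curryFun_isSeparating (z : Z) : IsSeparating 𝔸 (curryFun h z) where
  finSupp := curryFun_finSupp h z
  dom_iff x := by
    rw [curryFun_isSome_iff, separated_iff (curryFun_finSupp h z) (NominalSet.finSupp x),
      supp_curryFun]
  supp_eq := by
    refine Set.Subset.antisymm ?_ ?_
    · rw [supp_curryFun]
      rintro a ⟨x, H, h1⟩
      exact ⟨x, _, curryFun_apply h z x H, h1⟩
    · rintro a ⟨x, y, hxy, h1, h2⟩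
      exact (supp_subset_of_apply (curryFun_finSupp h z) hxy h1).resolve_right h2

/-- The transpose `Z → (X −∗ Y)` of an equivariant map `Z ∗ X → Y`. It is characterised by
`curry_apply` (equivalently `eval_curry`), see `curry_unique`. -/
noncomputable def curry : Z →[FinPerm 𝔸] Wand 𝔸 X Y where
  toFun z := ⟨curryFun h z, curryFun_isSeparating h z⟩
  map_smul' g z := Subtype.ext (curryFun_smul h g z)

theorem curry_apply (z : Z) (x : X) (H : Separated 𝔸 z x) :
    (curry h z).1 x = some (h (SepProd.mk z x H)) := curryFun_apply h z x H

theorem eval_curry (z : Z) (x : X) (H : Separated 𝔸 z x) :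
    Wand.eval 𝔸 X Y (SepProd.mk (curry h z) x (H.map_left (curry h))) = h (SepProd.mk z x H) := by
  apply Option.some_injective
  rw [Wand.some_eval, curry_apply]

theorem curry_unique (k : Z →[FinPerm 𝔸] Wand 𝔸 X Y)
    (hk : ∀ z x, ∀ H : Separated 𝔸 z x, (k z).1 x = some (h (SepProd.mk z x H))) :
    k = curry h := by
  ext z
  have fz : FinSupp 𝔸 z := NominalSet.finSupp z
  refine Wand.ext_fresh (supp_finite fz) fun x hx => ?_
  have H := (separated_iff fz (NominalSet.finSupp x)).2 hx
  rw [hk z x H, curry_apply]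

end Curry

/-! ## Functoriality of the wand -/

section WandMap

variable {𝔸 : Type v} [Infinite 𝔸] (W : Type u) {X Y Z : Type w}
  [MulAction (FinPerm 𝔸) W] [NominalSet 𝔸 W]
  [MulAction (FinPerm 𝔸) X] [MulAction (FinPerm 𝔸) Y] [MulAction (FinPerm 𝔸) Z]

/-- The action `W −∗ f` of the functor `W −∗ (·)` on an equivariant map `f : X → Y`: the transpose
of `f ∘ eval : (W −∗ X) ∗ W → Y`. -/
noncomputable def wandMap (f : X →[FinPerm 𝔸] Y) : Wand 𝔸 W X →[FinPerm 𝔸] Wand 𝔸 W Y :=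
  curry (f.comp (Wand.eval 𝔸 W X))

theorem wandMap_apply (f : X →[FinPerm 𝔸] Y) (p : Wand 𝔸 W X) (x : W) (H : Separated 𝔸 p x) :
    (wandMap W f p).1 x = some (f (Wand.eval 𝔸 W X (SepProd.mk p x H))) :=
  curry_apply _ p x H

theorem wandMap_id : wandMap W (MulActionHom.id (FinPerm 𝔸) : X →[FinPerm 𝔸] X) =
    MulActionHom.id (FinPerm 𝔸) := by
  symm
  apply curry_unique
  intro p x H
  exact (Wand.some_eval p x H).symm

theorem wandMap_comp (f : X →[FinPerm 𝔸] Y) (g : Y →[FinPerm 𝔸] Z) :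
    wandMap W (g.comp f) = (wandMap W g).comp (wandMap W f) := by
  symm
  apply curry_unique
  intro p x H
  change (wandMap W g (wandMap W f p)).1 x = some (g (f _))
  rw [wandMap_apply W g _ x (H.map_left (wandMap W f))]
  congr 2
  apply Option.some_injective
  rw [Wand.some_eval, wandMap_apply W f p x H]

end WandMap

/-! ## The category of nominal sets and the functor of separated automata -/

/-- Bundled nominal sets. -/
structure PermNom (𝔸 : Type v) : Type (max v (u + 1)) where
  /-- The underlying set. -/
  carrier : Type u
  [mulAction : MulAction (FinPerm 𝔸) carrier]
  [nominal : NominalSet 𝔸 carrier]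

attribute [instance] PermNom.mulAction PermNom.nominal

/-- Nominal sets and equivariant maps form a category. -/
instance (𝔸 : Type v) : Category.{u} (PermNom.{u} 𝔸) where
  Hom X Y := X.carrier →[FinPerm 𝔸] Y.carrier
  id X := MulActionHom.id (FinPerm 𝔸)
  comp f g := MulActionHom.comp g f

section Automata

variable {𝔸 : Type v}

/-- The nominal set `X^(*)` of separated words. -/
def PermNom.sepWord (X : PermNom.{u} 𝔸) : PermNom.{u} 𝔸 where
  carrier := SepWord 𝔸 X.carrier

/-- The nominal set `X −∗ Y`. -/
def PermNom.wand (X Y : PermNom.{u} 𝔸) : PermNom.{u} 𝔸 where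
  carrier := Wand 𝔸 X.carrier Y.carrier

variable [Infinite 𝔸]

/-- The functor `S(X) = O × (Sig −∗ X)` on nominal sets. -/
noncomputable def sepFunctor (Sig O : PermNom.{u} 𝔸) : PermNom.{u} 𝔸 ⥤ PermNom.{u} 𝔸 where
  obj X := { carrier := O.carrier × Wand 𝔸 Sig.carrier X.carrier }
  map f :=
    { toFun := fun p => (p.1, wandMap Sig.carrier f p.2)
      map_smul' := fun g p => Prod.ext rfl (map_smul (wandMap Sig.carrier f) g p.2) }
  map_id _ := MulActionHom.ext fun p =>
    Prod.ext rfl (DFunLike.congr_fun (wandMap_id Sig.carrier) p.2)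
  map_comp f g := MulActionHom.ext fun p =>
    Prod.ext rfl (DFunLike.congr_fun (wandMap_comp Sig.carrier f g) p.2)

variable {Sig O : PermNom.{u} 𝔸} (Q : Endofunctor.Coalgebra (sepFunctor Sig O))

/-- The structure map of a coalgebra, as an equivariant map `Q → O × (Sig −∗ Q)`. -/
def strFn : Q.V.carrier →[FinPerm 𝔸] O.carrier × Wand 𝔸 Sig.carrier Q.V.carrier := Q.str

/-- The output map `o : Q → O` of a separated automaton. -/
def outFn : Q.V.carrier →[FinPerm 𝔸] O.carrier where
  toFun q := (strFn Q q).1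
  map_smul' g q := congrArg Prod.fst (map_smul (strFn Q) g q)

/-- The transposed transition map `Q → (Sig −∗ Q)`. -/
def transFlat : Q.V.carrier →[FinPerm 𝔸] Wand 𝔸 Sig.carrier Q.V.carrier where
  toFun q := (strFn Q q).2
  map_smul' g q := congrArg Prod.snd (map_smul (strFn Q) g q)

/-- The transition map `δ : Q ∗ Sig → Q`, `δ (q, a) = transFlat q a`. -/
def transFn : SepProd 𝔸 Q.V.carrier Sig.carrier →[FinPerm 𝔸] Q.V.carrier where
  toFun p := Wand.eval 𝔸 Sig.carrier Q.V.carrier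
    (SepProd.mk (transFlat Q p.1.1) p.1.2 (p.2.map_left (transFlat Q)))
  map_smul' g p := by
    rw [id, ← map_smul, SepProd.smul_mk]
    congr 1
    exact Subtype.ext (Prod.ext (map_smul (transFlat Q) g p.1.1) rfl)

theorem separated_trans {q : Q.V.carrier} {a : Sig.carrier} {l : List Sig.carrier}
    (hl : IsSepWord 𝔸 (a :: l)) (hq : Separated 𝔸 q (a :: l)) :
    Separated 𝔸 (transFn Q (SepProd.mk q a (separated_cons_iff.1 hq).1)) l :=
  separated_apply (transFn Q) _ (separated_cons_iff.1 hq).2 (isSepWord_cons_iff.1 hl).1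

/-- The recursion `s (q, ε) = o q`, `s (q, a l) = s (δ (q, a), l)` for `q # a l` and `a # l`. -/
def semList : (l : List Sig.carrier) → (q : Q.V.carrier) → IsSepWord 𝔸 l → Separated 𝔸 q l →
    O.carrier
  | [], q, _, _ => outFn Q q
  | a :: l, q, hl, hq =>
    semList l (transFn Q (SepProd.mk q a (separated_cons_iff.1 hq).1))
      (isSepWord_cons_iff.1 hl).2 (separated_trans Q hl hq)

theorem semList_congr {l l' : List Sig.carrier} {q q' : Q.V.carrier} (h1 : l = l') (h2 : q = q')
    {hl : IsSepWord 𝔸 l} {hq : Separated 𝔸 q l} {hl' : IsSepWord 𝔸 l'}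
    {hq' : Separated 𝔸 q' l'} : semList Q l q hl hq = semList Q l' q' hl' hq' := by
  subst h1 h2
  rfl

theorem semList_smul (g : FinPerm 𝔸) (l : List Sig.carrier) (q : Q.V.carrier)
    (hl : IsSepWord 𝔸 l) (hq : Separated 𝔸 q l) :
    semList Q (g • l) (g • q) (hl.smul g) (hq.smul g) = g • semList Q l q hl hq := by
  induction l generalizing q with
  | nil => exact map_smul (outFn Q) g q
  | cons a l ih =>
    have e := ih _ (isSepWord_cons_iff.1 hl).2 (separated_trans Q hl hq)
    change semList Q (g • l) _ _ _ = g • semList Q l _ _ _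
    rw [← e]
    refine semList_congr Q rfl ?_
    rw [← map_smul]
    rfl

/-- The separated language semantics `s : Q ∗ Sig^(*) → O` of a separated automaton. -/
def sepSem : SepProd 𝔸 Q.V.carrier (SepWord 𝔸 Sig.carrier) →[FinPerm 𝔸] O.carrier where
  toFun p := semList Q p.1.2.1 p.1.1 p.1.2.2 (separated_sepWord.1 p.2)
  map_smul' g p := semList_smul Q g p.1.2.1 p.1.1 p.1.2.2 (separated_sepWord.1 p.2)

/-- The transpose of the separated language semantics, as a morphism `Q ⟶ (Sig^(*) −∗ O)` of
nominal sets. -/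
noncomputable def sepSemFlat : Q.V ⟶ Sig.sepWord.wand O :=
  curry (sepSem Q)

end Automata

end SepAut

/-! Write `L` for the nominal set of separated languages `Σ^(*) −∗ O`. As for ordinary deterministic
automata, a language is determined by its value at the empty word and by its derivatives `w ↦ p (a
w)`, and a homomorphism into `L` has to send a state to the language it accepts. What is new is the
bookkeeping of separation.

The derivative comes from two transpositions. The equivariant map `((p, a), w) ↦ p (a w)` on `(L ∗
Σ) ∗ Σ^(*)` is well defined because `(p, a) # w` gives both `a # w` and `p # a w`. Its transpose is
`langDeriv : L ∗ Σ → L`, and the transpose of that is the component `L → (Σ −∗ L)` of the structure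
map. Letters can be peeled off on the left, although separated powers grow on the right, because
being a separated word is a symmetric pairwise condition (`isSepWord_cons_iff`).

A transpose `h♭ z` may have smaller support than `z`, hence a larger domain than the arguments fresh
for `z`, and there its values are not given directly by `h` at `z`. This does no harm: separating
functions that agree on all arguments fresh for some finite set are equal (`Wand.ext_fresh`). So
every equation between functions is tested on fresh arguments only, where `curry_apply` computes
both sides.

By `comp_langStr_iff`, a homomorphism is then a map `k` with `k(q)(ε) = o(q)` and whose
`a`-derivative of `k(q)` is `k(δ(q, a))` for `q # a`. The transpose of the semantics satisfies this
by the two recursion equations of `s` (`sepSemFlat_isHom`). Conversely, the two conditions force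
`k(q)(w) = s(q, w)` for `q # w` by induction on `w`, and `curry_unique` identifies `k` with the
transpose (`eq_sepSemFlat_of_isHom`). -/

namespace SepAut

/-! ### Separated languages: value at the empty word and derivatives -/

section Language

variable {𝔸 : Type v} [Infinite 𝔸] {X : Type u} {Y : Type w}
  [MulAction (FinPerm 𝔸) X] [NominalSet 𝔸 X] [MulAction (FinPerm 𝔸) Y]

variable (𝔸 X) in
/-- The empty separated word. -/
def SepWord.nil : SepWord 𝔸 X := ⟨[], IsSepWord.nil⟩

/-- The separated word `a w`, for `a # w`. -/
def SepWord.cons (a : X) (w : SepWord 𝔸 X) (h : Separated 𝔸 a w) : SepWord 𝔸 X :=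
  ⟨a :: w.1, isSepWord_cons_iff.2 ⟨separated_sepWord.1 h, w.2⟩⟩

theorem separated_sepWord_nil {Z : Type*} [MulAction (FinPerm 𝔸) Z] [NominalSet 𝔸 Z] (z : Z) :
    Separated 𝔸 z (SepWord.nil 𝔸 X) :=
  separated_sepWord.2 (separated_list_iff.2 fun _ h => absurd h List.not_mem_nil)

theorem separated_sepWord_cons_iff {Z : Type*} [MulAction (FinPerm 𝔸) Z] [NominalSet 𝔸 Z] {z : Z}
    {a : X} {w : SepWord 𝔸 X} {h : Separated 𝔸 a w} :
    Separated 𝔸 z (SepWord.cons a w h) ↔ Separated 𝔸 z a ∧ Separated 𝔸 z w := by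
  rw [separated_sepWord, separated_sepWord (l := w)]
  exact separated_cons_iff

/-- A set supporting a pair supports both components, and the union of the supports of the
components supports the pair. Together with `separated_sepWord_cons_iff` this turns `(p, a) # w`
into the conditions needed to form `p (a w)`. -/
theorem separated_sepProd_iff [NominalSet 𝔸 Y] {Z : Type*} [MulAction (FinPerm 𝔸) Z] [NominalSet 𝔸 Z] {z : Z}
    {x : X} {y : Y} {h : Separated 𝔸 x y} :
    Separated 𝔸 (SepProd.mk x y h) z ↔ Separated 𝔸 x z ∧ Separated 𝔸 y z := by
  constructor
  · rintro ⟨C, D, hC, hD, hd, h1, h2⟩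
    exact ⟨⟨C, D, hC, hD, hd, fun g hg => congrArg (fun p => p.1.1) (h1 g hg), h2⟩,
      ⟨C, D, hC, hD, hd, fun g hg => congrArg (fun p => p.1.2) (h1 g hg), h2⟩⟩
  · rintro ⟨h1, h2⟩
    -- The pair is its own image under the identity, so the general fact about equivariant images
    -- applies.
    exact separated_apply (MulActionHom.id (FinPerm 𝔸)) h h1 h2

/-- The value of a separated language at the empty word. -/
noncomputable def langOut : Wand 𝔸 (SepWord 𝔸 X) Y →[FinPerm 𝔸] Y where
  toFun p := Wand.eval 𝔸 (SepWord 𝔸 X) Y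
    (SepProd.mk p (SepWord.nil 𝔸 X) (separated_sepWord_nil p))
  map_smul' g p := by
    rw [id, ← map_smul]
    rfl

theorem some_langOut (p : Wand 𝔸 (SepWord 𝔸 X) Y) :
    some (langOut p) = p.1 (SepWord.nil 𝔸 X) :=
  Wand.some_eval _ _ _

theorem separated_cons_of_sepProd {p : SepProd 𝔸 (Wand 𝔸 (SepWord 𝔸 X) Y) X} {w : SepWord 𝔸 X}
    (h : Separated 𝔸 p w) :
    Separated 𝔸 p.1.1 (SepWord.cons p.1.2 w (separated_sepProd_iff (h := p.2).1 h).2) :=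
  separated_sepWord_cons_iff.2 ⟨p.2, (separated_sepProd_iff (h := p.2).1 h).1⟩

variable (𝔸 X Y) in
/-- The map `((p, a), w) ↦ p (a w)`. -/
noncomputable def evalCons :
    SepProd 𝔸 (SepProd 𝔸 (Wand 𝔸 (SepWord 𝔸 X) Y) X) (SepWord 𝔸 X) →[FinPerm 𝔸] Y where
  toFun t := Wand.eval 𝔸 (SepWord 𝔸 X) Y
    (SepProd.mk t.1.1.1.1 (SepWord.cons t.1.1.1.2 t.1.2 _) (separated_cons_of_sepProd t.2))
  map_smul' g t := by
    -- Equivariance of evaluation moves `g` onto the pair; the action on words is letterwise, so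
    -- both arguments then agree by definition.
    rw [id, ← map_smul]
    rfl

variable (𝔸 X Y) in
/-- The derivative `(p, a) ↦ (w ↦ p (a w))` of separated languages. -/
noncomputable def langDeriv :
    SepProd 𝔸 (Wand 𝔸 (SepWord 𝔸 X) Y) X →[FinPerm 𝔸] Wand 𝔸 (SepWord 𝔸 X) Y :=
  curry (evalCons 𝔸 X Y)

/-- Separation of `w` from both `p` and `a` places `w` where the transpose is given directly by
`evalCons`. The derivative may be defined at further words, at which `a w` need not be a separated
word. -/
theorem langDeriv_apply {p : Wand 𝔸 (SepWord 𝔸 X) Y} {a : X} {w : SepWord 𝔸 X}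
    (hpa : Separated 𝔸 p a) (hpw : Separated 𝔸 p w) (haw : Separated 𝔸 a w) :
    (langDeriv 𝔸 X Y (SepProd.mk p a hpa)).1 w = p.1 (SepWord.cons a w haw) := by
  rw [langDeriv, curry_apply _ _ _ (separated_sepProd_iff.2 ⟨hpw, haw⟩)]
  exact Wand.some_eval _ _ _

end Language

/-! ### Finality of the coalgebra of separated languages -/

section Final

variable {𝔸 : Type v} [Infinite 𝔸] {Sig O : PermNom.{u} 𝔸}

variable (Sig O) in
/-- The coalgebra structure on separated languages: the value at the empty word and the
derivatives. -/
noncomputable def langStr :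
    Sig.sepWord.wand O ⟶ (sepFunctor Sig O).obj (Sig.sepWord.wand O) where
  toFun p := (langOut p, curry (langDeriv 𝔸 Sig.carrier O.carrier) p)
  map_smul' g p := Prod.ext (map_smul langOut g p)
    (map_smul (curry (langDeriv 𝔸 Sig.carrier O.carrier)) g p)

variable (Sig O) in
/-- The coalgebra of separated languages. -/
noncomputable abbrev langCoalgebra : Endofunctor.Coalgebra (sepFunctor Sig O) :=
  ⟨Sig.sepWord.wand O, langStr Sig O⟩

variable (Q : Endofunctor.Coalgebra (sepFunctor Sig O))

theorem sepSem_nil (q : Q.V.carrier) :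
    sepSem Q (SepProd.mk q (SepWord.nil 𝔸 Sig.carrier) (separated_sepWord_nil q)) = outFn Q q :=
  rfl

/-- The support of `δ(q, a)` is contained in the union of those of `q` and `a`, so the remaining
word can be read from the successor state. -/
theorem separated_transFn {q : Q.V.carrier} {a : Sig.carrier} {w : SepWord 𝔸 Sig.carrier}
    (hqa : Separated 𝔸 q a) (hqw : Separated 𝔸 q w) (haw : Separated 𝔸 a w) :
    Separated 𝔸 (transFn Q (SepProd.mk q a hqa)) w :=
  separated_apply (transFn Q) hqa hqw haw

theorem sepSem_cons {q : Q.V.carrier} {a : Sig.carrier} {w : SepWord 𝔸 Sig.carrier}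
    (hqa : Separated 𝔸 q a) (hqw : Separated 𝔸 q w) (haw : Separated 𝔸 a w) :
    sepSem Q (SepProd.mk q (SepWord.cons a w haw) (separated_sepWord_cons_iff.2 ⟨hqa, hqw⟩)) =
      sepSem Q (SepProd.mk (transFn Q (SepProd.mk q a hqa)) w
        (separated_transFn Q hqa hqw haw)) :=
  rfl

/-- An equivariant map into the separated languages is a coalgebra homomorphism iff it preserves
outputs and commutes with transitions. -/
theorem comp_langStr_iff
    (k : Q.V.carrier →[FinPerm 𝔸] Wand 𝔸 (SepWord 𝔸 Sig.carrier) O.carrier) :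
    (Q.str ≫ (sepFunctor Sig O).map (Y := Sig.sepWord.wand O) k =
      CategoryStruct.comp (Y := Sig.sepWord.wand O) k (langStr Sig O)) ↔
    (∀ q, langOut (k q) = outFn Q q) ∧
      ∀ q a, ∀ h : Separated 𝔸 q a, langDeriv 𝔸 Sig.carrier O.carrier
        (SepProd.mk (k q) a (h.map_left k)) = k (transFn Q (SepProd.mk q a h)) := by
  -- The functor acts by postcomposition with `k` after evaluation, and evaluating `transFlat Q q`
  -- at `a` is `δ(q, a)` by definition.
  have map_trans : ∀ q a, ∀ h : Separated 𝔸 q a,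
      (wandMap Sig.carrier k (transFlat Q q)).1 a = some (k (transFn Q (SepProd.mk q a h))) :=
    fun q a h => wandMap_apply _ k _ a (h.map_left (transFlat Q))
  constructor
  · intro hk
    have hq : ∀ q, ((outFn Q q, wandMap Sig.carrier k (transFlat Q q)) : _ × _) =
        (langOut (k q), curry (langDeriv 𝔸 Sig.carrier O.carrier) (k q)) :=
      fun q => DFunLike.congr_fun (F := Q.V.carrier →[FinPerm 𝔸]
        O.carrier × Wand 𝔸 Sig.carrier (Wand 𝔸 (SepWord 𝔸 Sig.carrier) O.carrier)) hk q
    refine ⟨fun q => (congrArg Prod.fst (hq q)).symm, fun q a h => ?_⟩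
    apply Option.some_injective
    have e := congrArg Prod.snd (hq q)
    dsimp only at e
    -- The second components are equal elements of `Σ −∗ L`; comparing their values at `a` gives the
    -- derivative condition.
    rw [← map_trans, e, curry_apply]
  · rintro ⟨h1, h2⟩
    refine MulActionHom.ext fun q => Prod.ext (h1 q).symm ?_
    change wandMap Sig.carrier k (transFlat Q q) =
      curry (langDeriv 𝔸 Sig.carrier O.carrier) (k q)
    have fq : FinSupp 𝔸 q := NominalSet.finSupp q
    -- The letters are tested against `supp q` rather than the possibly smaller support of `k q`,
    -- because `δ(q, a)` needs `q # a`.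
    refine Wand.ext_fresh (supp_finite fq) fun a ha => ?_
    have h := (separated_iff fq (NominalSet.finSupp a)).2 ha
    rw [map_trans q a h, curry_apply _ _ _ (h.map_left k), h2]

theorem sepSemFlat_isHom : Q.str ≫ (sepFunctor Sig O).map (sepSemFlat Q) =
    sepSemFlat Q ≫ langStr Sig O := by
  refine (comp_langStr_iff Q (curry (sepSem Q))).2 ⟨fun q => ?_, fun q a h => ?_⟩
  · apply Option.some_injective
    rw [some_langOut, curry_apply _ _ _ (separated_sepWord_nil q), sepSem_nil]
  · have f : FinSupp 𝔸 (SepProd.mk q a h) := NominalSet.finSupp _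
    -- For `w` fresh for both `q` and `a`, each side is computed from the semantics: `s(q, a w)` on
    -- the left, `s(δ(q, a), w)` on the right.
    refine Wand.ext_fresh (supp_finite f) fun w hw => ?_
    obtain ⟨hqw, haw⟩ :=
      separated_sepProd_iff.1 ((separated_iff f (NominalSet.finSupp w)).2 hw)
    rw [langDeriv_apply _ (hqw.map_left _) haw,
      curry_apply _ _ _ (separated_sepWord_cons_iff.2 ⟨h, hqw⟩), sepSem_cons Q h hqw haw,
      curry_apply _ _ _ (separated_transFn Q h hqw haw)]

theorem eq_sepSemFlat_of_isHom (k : Q.V ⟶ Sig.sepWord.wand O)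
    (hk : Q.str ≫ (sepFunctor Sig O).map k = k ≫ langStr Sig O) : k = sepSemFlat Q := by
  obtain ⟨h1, h2⟩ := (comp_langStr_iff Q k).1 hk
  refine curry_unique (sepSem Q) k ?_
  rintro q ⟨l, hl⟩ H
  -- The state must vary, since the tail of the word is read from `δ(q, a)`.
  induction l generalizing q with
  | nil => exact (some_langOut _).symm.trans (congrArg some (h1 q))
  | cons a l ih =>
    obtain ⟨hal, hl'⟩ := isSepWord_cons_iff.1 hl
    let w : SepWord 𝔸 Sig.carrier := ⟨l, hl'⟩
    have haw : Separated 𝔸 a w := separated_sepWord.2 hal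
    obtain ⟨hqa, hqw⟩ := separated_sepWord_cons_iff (h := haw).1 H
    have e := ih _ hl' (separated_transFn Q hqa hqw haw)
    -- The induction hypothesis concerns `k(δ(q, a))(w)`; this replaces `k(δ(q, a))` by the
    -- `a`-derivative of `k(q)`.
    rw [← h2 q a hqa] at e
    -- The derivative at `w` is `k(q)(a w)`, and the right-hand side `s(δ(q, a), w)` of `e` is `s(q,
    -- a w)` by definitional unfolding.
    exact (langDeriv_apply (hqa.map_left k) (hqw.map_left k) haw).symm.trans e

end Final

end SepAut

theorem proposition4p11 (𝔸 : Type v) [Countable 𝔸] [Infinite 𝔸]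
    (Sig O : SepAut.PermNom.{u} 𝔸) :
    ∃ ζ : Sig.sepWord.wand O ⟶ (SepAut.sepFunctor Sig O).obj (Sig.sepWord.wand O),
      Nonempty (Limits.IsTerminal
        (⟨Sig.sepWord.wand O, ζ⟩ : Endofunctor.Coalgebra (SepAut.sepFunctor Sig O))) ∧
      ∀ (Q : Endofunctor.Coalgebra (SepAut.sepFunctor Sig O))
        (h : Q ⟶ (⟨Sig.sepWord.wand O, ζ⟩ :
          Endofunctor.Coalgebra (SepAut.sepFunctor Sig O))),
        h.f = SepAut.sepSemFlat Q := by
  refine ⟨SepAut.langStr Sig O, ⟨Limits.IsTerminal.ofUniqueHom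
    (fun Q => ⟨SepAut.sepSemFlat Q, SepAut.sepSemFlat_isHom Q⟩) fun Q m => ?_⟩, fun Q h => ?_⟩
  · exact Endofunctor.Coalgebra.Hom.ext (SepAut.eq_sepSemFlat_of_isHom Q m.f m.h)
  · exact SepAut.eq_sepSemFlat_of_isHom Q h.f h.h
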